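/- Let $r\ge 2$ be an integer, and let $\tau^*(n)=2^{\omega(n)}$, where $\omega(n)$ is the number of distinct prime factors of the positive integer $n$. There is a polynomial $P^*_r$ with real coefficients, depending only on $r$, of degree exactly $r$ and with leading coefficient $$\prod_p \left(1-\frac1p\right)^r\left(2-\left(1-\frac1p\right)^r\right),$$ where the (convergent) product is over all primes $p$, such that for every $\varepsilon>0$, as $x\to\infty$ over the reals, $$\sum_{1\le n_1,\ldots,n_r\le x} \tau^*(n_1\cdots n_r) = x^r P^*_r(\log x) + O_{r,\varepsilon}\!\left(x^{r-1/2+\varepsilon}\right),$$ the sum being over all $r$-tuples of positive integers at most $x$ and the implied constant depending only on $r$ and $\varepsilon$. -/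

import Mathlib

/-- The number of unitary divisors of `n`, `τ*(n) = 2 ^ ω(n)`, where `ω(n)` is the number of
distinct prime factors of `n`. -/
def tauStar (n : ℕ) : ℕ := 2 ^ ArithmeticFunction.cardDistinctFactors n

/-- The sum of `τ*(n₁ ⋯ n_r)` over all `r`-tuples of integers `1 ≤ n₁, …, n_r ≤ x`. -/
noncomputable def tauStarSum (r : ℕ) (x : ℝ) : ℕ :=
  ∑ n ∈ Fintype.piFinset (fun _ : Fin r => Finset.Icc 1 ⌊x⌋₊), tauStar (∏ i, n i)

section

open Finset

/-- The convolution of a function on `r`-tuples with an arithmetic function, in each coordinate. -/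
noncomputable def tupleConv {r : ℕ} (F : (Fin r → ℕ) → ℝ) (χ : ArithmeticFunction ℝ)
    (n : Fin r → ℕ) : ℝ :=
  ∑ x ∈ Fintype.piFinset (fun i => (n i).divisorsAntidiagonal),
    F (fun i => (x i).1) * ∏ i, χ (x i).2

/-- Multiplicativity of a function of `r`-tuples. -/
def TupleMultiplicative {r : ℕ} (F : (Fin r → ℕ) → ℝ) : Prop :=
  ∀ m n : Fin r → ℕ, Nat.Coprime (∏ i, m i) (∏ i, n i) → F (m * n) = F m * F n

lemma tupleConv_eq_zero {r : ℕ} (F : (Fin r → ℕ) → ℝ) (χ : ArithmeticFunction ℝ)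
    {n : Fin r → ℕ} {i : Fin r} (hi : n i = 0) : tupleConv F χ n = 0 := by
  unfold tupleConv
  refine sum_eq_zero fun x hx => ?_
  have := Fintype.mem_piFinset.mp hx i
  simp [hi] at this

lemma tupleConv_assoc {r : ℕ} (F : (Fin r → ℕ) → ℝ) (χ ψ : ArithmeticFunction ℝ) :
    tupleConv (tupleConv F χ) ψ = tupleConv F (χ * ψ) := by
  ext n
  simp only [tupleConv, ArithmeticFunction.mul_apply, prod_univ_sum, sum_mul, mul_sum, sum_sigma']
  apply sum_nbij'
    (fun s => ⟨fun i => ((s.2 i).1, (s.2 i).2 * (s.1 i).2), fun i => ((s.2 i).2, (s.1 i).2)⟩)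
    (fun s => ⟨fun i => ((s.1 i).1 * (s.2 i).1, (s.2 i).2), fun i => ((s.1 i).1, (s.2 i).1)⟩)
  · rintro ⟨x, y⟩ h
    simp only [mem_sigma, Fintype.mem_piFinset, Nat.mem_divisorsAntidiagonal] at h ⊢
    refine ⟨fun i => ⟨?_, (h.1 i).2⟩, fun i => ⟨trivial, ?_⟩⟩
    · rw [← mul_assoc, (h.2 i).1, (h.1 i).1]
    · intro h0
      have := (h.1 i)
      rw [← (h.2 i).1, mul_assoc, h0] at this
      simp only [mul_zero] at this
      exact this.2 this.1.symm
  · rintro ⟨x, y⟩ h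
    simp only [mem_sigma, Fintype.mem_piFinset, Nat.mem_divisorsAntidiagonal] at h ⊢
    refine ⟨fun i => ⟨?_, (h.1 i).2⟩, fun i => ⟨trivial, ?_⟩⟩
    · rw [mul_assoc, (h.2 i).1, (h.1 i).1]
    · intro h0
      have := (h.1 i)
      rw [← (h.2 i).1, ← mul_assoc, h0] at this
      simp only [zero_mul] at this
      exact this.2 this.1.symm
  · rintro ⟨x, y⟩ h
    simp only [mem_sigma, Fintype.mem_piFinset, Nat.mem_divisorsAntidiagonal] at h ⊢
    have : (fun i => ((y i).1 * (y i).2, (x i).2)) = x := funext fun i => by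
      rw [(h.2 i).1]
    simp [this]
  · rintro ⟨x, y⟩ h
    simp only [mem_sigma, Fintype.mem_piFinset, Nat.mem_divisorsAntidiagonal] at h ⊢
    have : (fun i => ((x i).1, (y i).1 * (y i).2)) = x := funext fun i => by
      rw [(h.2 i).1]
    simp [this]
  · rintro ⟨x, y⟩ h
    simp only [prod_mul_distrib, mul_assoc]

lemma tupleConv_one {r : ℕ} (F : (Fin r → ℕ) → ℝ) {n : Fin r → ℕ} (hn : ∀ i, n i ≠ 0) :
    tupleConv F 1 n = F n := by
  unfold tupleConv
  rw [sum_eq_single (fun i => (n i, 1))]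
  · simp
  · intro x hx hne
    obtain ⟨i, hi⟩ : ∃ i, (x i).2 ≠ 1 := by
      by_contra! h
      refine hne (funext fun i => ?_)
      have := (Nat.mem_divisorsAntidiagonal.mp (Fintype.mem_piFinset.mp hx i)).1
      rw [h i, mul_one] at this
      exact Prod.ext this (h i)
    rw [prod_eq_zero (mem_univ i) (ArithmeticFunction.one_apply_ne hi), mul_zero]
  · intro h
    exact absurd (Fintype.mem_piFinset.mpr fun i => by simp [hn i]) h

lemma tupleConv_sub {r : ℕ} (F G : (Fin r → ℕ) → ℝ) (χ : ArithmeticFunction ℝ) (n : Fin r → ℕ) :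
    tupleConv (fun d => F d - G d) χ n = tupleConv F χ n - tupleConv G χ n := by
  simp only [tupleConv, sub_mul, sum_sub_distrib]

lemma tupleConv_const_mul {r : ℕ} (a : ℝ) (F : (Fin r → ℕ) → ℝ) (χ : ArithmeticFunction ℝ)
    (n : Fin r → ℕ) : tupleConv (fun d => a * F d) χ n = a * tupleConv F χ n := by
  simp only [tupleConv, mul_assoc, mul_sum]

lemma tupleConv_prod {r : ℕ} (ψ χ : ArithmeticFunction ℝ) (n : Fin r → ℕ) :
    tupleConv (fun d => ∏ i, ψ (d i)) χ n = ∏ i, (ψ * χ) (n i) := by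
  simp only [tupleConv, ArithmeticFunction.mul_apply, prod_univ_sum, prod_mul_distrib]

lemma tupleConv_congr {r : ℕ} {F G : (Fin r → ℕ) → ℝ} (χ : ArithmeticFunction ℝ) {n : Fin r → ℕ}
    (h : ∀ d : Fin r → ℕ, (∀ i, d i ∣ n i) → F d = G d) : tupleConv F χ n = tupleConv G χ n := by
  refine sum_congr rfl fun x hx => ?_
  rw [h]
  exact fun i => ⟨_, (Nat.mem_divisorsAntidiagonal.mp (Fintype.mem_piFinset.mp hx i)).1.symm⟩

lemma sum_tupleConv {r : ℕ} (F : (Fin r → ℕ) → ℝ) (χ : ArithmeticFunction ℝ) (X : ℕ) :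
    ∑ n ∈ Fintype.piFinset (fun _ : Fin r => Icc 1 X), tupleConv F χ n =
      ∑ d ∈ Fintype.piFinset (fun _ : Fin r => Icc 1 X),
        F d * ∏ i, ∑ m ∈ Ioc 0 (X / d i), χ m := by
  simp only [tupleConv, prod_univ_sum, mul_sum, sum_sigma']
  apply sum_nbij' (fun s => ⟨fun i => (s.2 i).1, fun i => (s.2 i).2⟩)
    (fun s => ⟨fun i => s.1 i * s.2 i, fun i => (s.1 i, s.2 i)⟩)
  · rintro ⟨x, y⟩ h
    simp only [mem_sigma, Fintype.mem_piFinset, Nat.mem_divisorsAntidiagonal, mem_Icc,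
      mem_Ioc] at h ⊢
    have h1 : ∀ i, 0 < (y i).1 := fun i => Nat.pos_of_ne_zero fun h0 => by
      have := (h.2 i); rw [h0, zero_mul] at this; exact this.2 this.1.symm
    have h2 : ∀ i, 0 < (y i).2 := fun i => Nat.pos_of_ne_zero fun h0 => by
      have := (h.2 i); rw [h0, mul_zero] at this; exact this.2 this.1.symm
    refine ⟨fun i => ⟨h1 i, ?_⟩, fun i => ⟨h2 i, ?_⟩⟩
    · exact (Nat.le_mul_of_pos_right _ (h2 i)).trans ((h.2 i).1 ▸ (h.1 i).2)
    · rw [Nat.le_div_iff_mul_le (h1 i), mul_comm, (h.2 i).1]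
      exact (h.1 i).2
  · rintro ⟨x, y⟩ h
    simp only [mem_sigma, Fintype.mem_piFinset, Nat.mem_divisorsAntidiagonal, mem_Icc,
      mem_Ioc] at h ⊢
    refine ⟨fun i => ⟨Nat.mul_pos (h.1 i).1 (h.2 i).1, ?_⟩, fun i =>
      ⟨trivial, (Nat.mul_pos (h.1 i).1 (h.2 i).1).ne'⟩⟩
    have := (h.2 i).2
    rwa [Nat.le_div_iff_mul_le (h.1 i).1, mul_comm] at this
  · rintro ⟨x, y⟩ h
    simp only [mem_sigma, Fintype.mem_piFinset, Nat.mem_divisorsAntidiagonal] at h ⊢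
    have : (fun i => (y i).1 * (y i).2) = x := funext fun i => (h.2 i).1
    simp [this]
  · rintro ⟨x, y⟩ h
    rfl
  · rintro ⟨x, y⟩ h
    rfl

lemma gcd_mul_left_of_dvd_of_coprime {a b m n : ℕ} (ha : a ∣ m) (hb : b ∣ n)
    (h : Nat.Coprime m n) : Nat.gcd (a * b) m = a := by
  rw [Nat.Coprime.gcd_mul_right_cancel _ (h.symm.coprime_dvd_left hb), Nat.gcd_eq_left ha]

lemma gcd_mul_right_of_dvd_of_coprime {a b m n : ℕ} (ha : a ∣ m) (hb : b ∣ n)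
    (h : Nat.Coprime m n) : Nat.gcd (a * b) n = b := by
  rw [mul_comm, gcd_mul_left_of_dvd_of_coprime hb ha h.symm]

lemma gcd_mul_gcd_of_dvd_mul {a m n : ℕ} (h : Nat.Coprime m n) (ha : a ∣ m * n) :
    Nat.gcd a m * Nat.gcd a n = a := by
  rw [← Nat.Coprime.gcd_mul _ h, Nat.gcd_eq_left ha]

lemma eq_and_eq_of_mul_eq_mul_of_coprime {A B m n : ℕ} (hA : Nat.Coprime A n)
    (hB : Nat.Coprime B m) (e : A * B = m * n) : A = m ∧ B = n := by
  refine ⟨Nat.dvd_antisymm ?_ ?_, Nat.dvd_antisymm ?_ ?_⟩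
  · exact hA.dvd_of_dvd_mul_right (e ▸ Dvd.intro _ rfl)
  · exact hB.symm.dvd_of_dvd_mul_right (e ▸ Dvd.intro _ rfl)
  · exact hB.dvd_of_dvd_mul_left (e ▸ Dvd.intro_left _ rfl)
  · exact hA.symm.dvd_of_dvd_mul_left (e ▸ Dvd.intro_left _ rfl)

lemma TupleMultiplicative.tupleConv {r : ℕ} {F : (Fin r → ℕ) → ℝ} (hF : TupleMultiplicative F)
    {χ : ArithmeticFunction ℝ} (hχ : χ.IsMultiplicative) :
    TupleMultiplicative (tupleConv F χ) := by
  intro m n hmn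
  have hc : ∀ i, Nat.Coprime (m i) (n i) := fun i =>
    (hmn.coprime_dvd_left (dvd_prod_of_mem m (mem_univ i))).coprime_dvd_right
      (dvd_prod_of_mem n (mem_univ i))
  simp only [_root_.tupleConv]
  rw [sum_mul_sum, ← sum_product']
  symm
  apply sum_nbij' (fun s i => ((s.1 i).1 * (s.2 i).1, (s.1 i).2 * (s.2 i).2))
    (fun x => (fun i => (Nat.gcd (x i).1 (m i), Nat.gcd (x i).2 (m i)),
      fun i => (Nat.gcd (x i).1 (n i), Nat.gcd (x i).2 (n i))))
  · rintro ⟨x, y⟩ h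
    simp only [mem_product, Fintype.mem_piFinset, Nat.mem_divisorsAntidiagonal,
      Pi.mul_apply] at h ⊢
    refine fun i => ⟨?_, mul_ne_zero (h.1 i).2 (h.2 i).2⟩
    rw [← (h.1 i).1, ← (h.2 i).1]; ring
  · intro x h
    simp only [mem_product, Fintype.mem_piFinset, Nat.mem_divisorsAntidiagonal,
      Pi.mul_apply] at h ⊢
    have key : ∀ i, Nat.gcd (x i).1 (m i) * Nat.gcd (x i).2 (m i) = m i ∧
        Nat.gcd (x i).1 (n i) * Nat.gcd (x i).2 (n i) = n i := by
      intro i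
      have h1 := gcd_mul_gcd_of_dvd_mul (hc i) ⟨_, (h i).1.symm⟩
      have h2 := gcd_mul_gcd_of_dvd_mul (hc i) ⟨_, ((mul_comm _ _).trans (h i).1).symm⟩
      have h3 : (Nat.gcd (x i).1 (m i) * Nat.gcd (x i).2 (m i)) *
          (Nat.gcd (x i).1 (n i) * Nat.gcd (x i).2 (n i)) = m i * n i := by
        rw [← (h i).1]; conv_rhs => rw [← h1, ← h2]
        ring
      exact eq_and_eq_of_mul_eq_mul_of_coprime
        (((hc i).coprime_dvd_left (Nat.gcd_dvd_right _ _)).mul_left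
          ((hc i).coprime_dvd_left (Nat.gcd_dvd_right _ _)))
        (((hc i).symm.coprime_dvd_left (Nat.gcd_dvd_right _ _)).mul_left
          ((hc i).symm.coprime_dvd_left (Nat.gcd_dvd_right _ _))) h3
    exact ⟨fun i => ⟨(key i).1, fun h0 => (h i).2 (by rw [h0, zero_mul])⟩,
      fun i => ⟨(key i).2, fun h0 => (h i).2 (by rw [h0, mul_zero])⟩⟩
  · rintro ⟨x, y⟩ h
    simp only [mem_product, Fintype.mem_piFinset, Nat.mem_divisorsAntidiagonal] at h ⊢
    have hx1 : ∀ i, (x i).1 ∣ m i := fun i => ⟨_, (h.1 i).1.symm⟩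
    have hx2 : ∀ i, (x i).2 ∣ m i := fun i => ⟨_, ((mul_comm _ _).trans (h.1 i).1).symm⟩
    have hy1 : ∀ i, (y i).1 ∣ n i := fun i => ⟨_, (h.2 i).1.symm⟩
    have hy2 : ∀ i, (y i).2 ∣ n i := fun i => ⟨_, ((mul_comm _ _).trans (h.2 i).1).symm⟩
    refine Prod.ext (funext fun i => Prod.ext ?_ ?_) (funext fun i => Prod.ext ?_ ?_)
    · exact gcd_mul_left_of_dvd_of_coprime (hx1 i) (hy1 i) (hc i)
    · exact gcd_mul_left_of_dvd_of_coprime (hx2 i) (hy2 i) (hc i)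
    · exact gcd_mul_right_of_dvd_of_coprime (hx1 i) (hy1 i) (hc i)
    · exact gcd_mul_right_of_dvd_of_coprime (hx2 i) (hy2 i) (hc i)
  · intro x h
    simp only [Fintype.mem_piFinset, Nat.mem_divisorsAntidiagonal, Pi.mul_apply] at h ⊢
    exact funext fun i => Prod.ext (gcd_mul_gcd_of_dvd_mul (hc i) ⟨_, (h i).1.symm⟩)
      (gcd_mul_gcd_of_dvd_mul (hc i) ⟨_, ((mul_comm _ _).trans (h i).1).symm⟩)
  · rintro ⟨x, y⟩ h
    simp only [mem_product, Fintype.mem_piFinset, Nat.mem_divisorsAntidiagonal] at h ⊢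
    have hx1 : (∏ i, (x i).1) ∣ ∏ i, m i := prod_dvd_prod_of_dvd _ _ fun i _ =>
      ⟨_, (h.1 i).1.symm⟩
    have hy1 : (∏ i, (y i).1) ∣ ∏ i, n i := prod_dvd_prod_of_dvd _ _ fun i _ =>
      ⟨_, (h.2 i).1.symm⟩
    have e1 : F (fun i => (x i).1 * (y i).1) = F (fun i => (x i).1) * F (fun i => (y i).1) :=
      hF _ _ ((hmn.coprime_dvd_left hx1).coprime_dvd_right hy1)
    have e2 : ∀ i, χ ((x i).2 * (y i).2) = χ (x i).2 * χ (y i).2 := fun i =>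
      hχ.2 (((hc i).coprime_dvd_left ⟨_, ((mul_comm _ _).trans (h.1 i).1).symm⟩).coprime_dvd_right
        ⟨_, ((mul_comm _ _).trans (h.2 i).1).symm⟩)
    rw [e1]
    simp only [e2, prod_mul_distrib]
    ring

/-- The sum of `F` over the `r`-tuples with product `k`. -/
noncomputable def tupleSum {r : ℕ} (F : (Fin r → ℕ) → ℝ) (k : ℕ) : ℝ :=
  ∑ d ∈ Nat.finMulAntidiag r k, F d

lemma tupleSum_mul {r : ℕ} {F : (Fin r → ℕ) → ℝ} (hF : TupleMultiplicative F)
    {m n : ℕ} (h : Nat.Coprime m n) : tupleSum F (m * n) = tupleSum F m * tupleSum F n := by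
  simp only [tupleSum]
  rw [sum_mul_sum, ← sum_product']
  symm
  apply sum_nbij' (fun s => s.1 * s.2)
    (fun d => (fun i => Nat.gcd (d i) m, fun i => Nat.gcd (d i) n))
  · rintro ⟨x, y⟩ hxy
    simp only [mem_product, Nat.mem_finMulAntidiag] at hxy ⊢
    refine ⟨?_, mul_ne_zero hxy.1.2 hxy.2.2⟩
    simp only [Pi.mul_apply, prod_mul_distrib, hxy.1.1, hxy.2.1]
  · intro d hd
    have hdvd := fun i => Nat.dvd_of_mem_finMulAntidiag hd i
    simp only [mem_product, Nat.mem_finMulAntidiag] at hd ⊢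
    have e : (∏ i, Nat.gcd (d i) m) * (∏ i, Nat.gcd (d i) n) = m * n := by
      rw [← prod_mul_distrib, ← hd.1]
      exact prod_congr rfl fun i _ => gcd_mul_gcd_of_dvd_mul h (hdvd i)
    have c1 : Nat.Coprime (∏ i, Nat.gcd (d i) m) n := Nat.Coprime.prod_left fun i _ =>
      h.coprime_dvd_left (Nat.gcd_dvd_right _ _)
    have c2 : Nat.Coprime (∏ i, Nat.gcd (d i) n) m := Nat.Coprime.prod_left fun i _ =>
      h.symm.coprime_dvd_left (Nat.gcd_dvd_right _ _)
    obtain ⟨e1, e2⟩ := eq_and_eq_of_mul_eq_mul_of_coprime c1 c2 e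
    exact ⟨⟨e1, left_ne_zero_of_mul hd.2⟩, ⟨e2, right_ne_zero_of_mul hd.2⟩⟩
  · rintro ⟨x, y⟩ hxy
    rw [mem_product] at hxy
    have hx := fun i => Nat.dvd_of_mem_finMulAntidiag hxy.1 i
    have hy := fun i => Nat.dvd_of_mem_finMulAntidiag hxy.2 i
    exact Prod.ext (funext fun i => gcd_mul_left_of_dvd_of_coprime (hx i) (hy i) h)
      (funext fun i => gcd_mul_right_of_dvd_of_coprime (hx i) (hy i) h)
  · intro d hd
    exact funext fun i => gcd_mul_gcd_of_dvd_mul h (Nat.dvd_of_mem_finMulAntidiag hd i)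
  · rintro ⟨x, y⟩ hxy
    simp only [mem_product, Nat.mem_finMulAntidiag] at hxy
    exact (hF x y (by rw [hxy.1.1, hxy.2.1]; exact h)).symm

lemma tupleSum_zero {r : ℕ} (F : (Fin r → ℕ) → ℝ) : tupleSum F 0 = 0 := by
  simp [tupleSum]

lemma tupleSum_one {r : ℕ} (F : (Fin r → ℕ) → ℝ) : tupleSum F 1 = F 1 := by
  simp only [tupleSum, Nat.finMulAntidiag_one, sum_singleton]
  rfl

end

section

open Finset ArithmeticFunction

/-- The multiplicative function of `r`-tuples `g` such that
`τ*(n₁ ⋯ n_r)` is the convolution of `g` with `τ` in each coordinate. -/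
noncomputable def tauStarCoeff {r : ℕ} (d : Fin r → ℕ) : ℝ :=
  tupleConv (fun n => (tauStar (∏ i, n i) : ℝ)) ((moebius : ArithmeticFunction ℝ) * moebius) d

/-- The value of `μ` at `p ^ e`. -/
def localMoebius (e : ℕ) : ℝ := if e = 0 then 1 else if e = 1 then -1 else 0

/-- The value of `μ * μ` at `p ^ e`. -/
def localMoebiusSq (e : ℕ) : ℝ := if e = 0 then 1 else if e = 1 then -2 else if e = 2 then 1 else 0

/-- The value of `tauStarCoeff` at a tuple of powers of a prime. -/
def localCoeff {r : ℕ} (e : Fin r → ℕ) : ℝ :=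
  2 * ∏ i, localMoebius (e i) - ∏ i, localMoebiusSq (e i)

lemma moebius_prime_pow_eq {p : ℕ} (hp : p.Prime) (e : ℕ) :
    (moebius : ArithmeticFunction ℝ) (p ^ e) = localMoebius e := by
  unfold localMoebius
  rcases eq_or_ne e 0 with rfl | he
  · simp
  · rw [intCoe_apply, moebius_apply_prime_pow hp he, if_neg he]
    split_ifs <;> simp

lemma moebius_mul_moebius_prime_pow_eq {p : ℕ} (hp : p.Prime) (e : ℕ) :
    ((moebius : ArithmeticFunction ℝ) * moebius) (p ^ e) = localMoebiusSq e := by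
  have h : ((moebius : ArithmeticFunction ℝ) * moebius) (p ^ e) =
      ∑ i ∈ range (e + 1), localMoebius i * localMoebius (e - i) := by
    rw [mul_apply, Nat.sum_divisorsAntidiagonal
      (fun a b => (moebius : ArithmeticFunction ℝ) a * (moebius : ArithmeticFunction ℝ) b),
      Nat.sum_divisors_prime_pow hp]
    refine sum_congr rfl fun i hi => ?_
    rw [Nat.pow_div (Nat.lt_succ_iff.mp (mem_range.mp hi)) hp.pos, moebius_prime_pow_eq hp,
      moebius_prime_pow_eq hp]
  rw [h]
  rcases lt_or_ge e 3 with h3 | h3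
  · interval_cases e <;> norm_num [sum_range_succ, localMoebius, localMoebiusSq]
  · rw [localMoebiusSq, if_neg (by omega), if_neg (by omega), if_neg (by omega)]
    refine sum_eq_zero fun i _ => ?_
    unfold localMoebius
    rcases le_or_gt 2 i with hi | hi
    · rw [if_neg (by omega), if_neg (by omega), zero_mul]
    · rw [if_neg (show e - i ≠ 0 by omega), if_neg (show e - i ≠ 1 by omega), mul_zero]

lemma tauStar_one : tauStar 1 = 1 := by simp [tauStar]

lemma tauStarCoeff_prime_pow {r : ℕ} {p : ℕ} (hp : p.Prime) (e : Fin r → ℕ) :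
    tauStarCoeff (fun i => p ^ e i) = localCoeff e := by
  have h1 : ∀ d : Fin r → ℕ, (∀ i, d i ∣ p ^ e i) → (tauStar (∏ i, d i) : ℝ) =
      2 * ∏ i, (zeta : ArithmeticFunction ℝ) (d i) - ∏ i, (1 : ArithmeticFunction ℝ) (d i) := by
    intro d hd
    have hd' : ∀ i, ∃ k, d i = p ^ k := fun i => by
      obtain ⟨k, -, hk⟩ := (Nat.dvd_prime_pow hp).mp (hd i)
      exact ⟨k, hk⟩
    choose k hk using hd'
    have hz : ∀ i, (zeta : ArithmeticFunction ℝ) (d i) = 1 := fun i => by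
      rw [natCoe_apply, zeta_apply_ne (by rw [hk]; exact (pow_pos hp.pos _).ne'), Nat.cast_one]
    simp only [hz, prod_const_one]
    by_cases h : ∀ i, k i = 0
    · have : ∀ i, d i = 1 := fun i => by rw [hk, h, pow_zero]
      simp only [this, prod_const_one, one_one, tauStar_one]
      norm_num
    · push Not at h
      obtain ⟨i, hi⟩ := h
      have hdi : d i ≠ 1 := by
        rw [hk]
        exact (Nat.one_lt_pow hi hp.one_lt).ne'
      rw [prod_eq_zero (f := fun i => (1 : ArithmeticFunction ℝ) (d i)) (mem_univ i)
        (one_apply_ne hdi)]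
      have : ∏ i, d i = p ^ ∑ i, k i := by 
        rw [← prod_pow_eq_pow_sum]
        exact prod_congr rfl fun i _ => hk i
      have hs : ∑ i, k i ≠ 0 := fun h0 => hi (Finset.sum_eq_zero_iff.mp h0 i (mem_univ i))
      rw [this, tauStar, cardDistinctFactors_apply_prime_pow hp hs]
      norm_num
  rw [tauStarCoeff, tupleConv_congr _ h1, tupleConv_sub, tupleConv_const_mul, tupleConv_prod,
    tupleConv_prod, ← mul_assoc, coe_zeta_mul_coe_moebius, one_mul, one_mul]
  simp only [moebius_prime_pow_eq hp, moebius_mul_moebius_prime_pow_eq hp, localCoeff]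

lemma tauStar_tupleMultiplicative {r : ℕ} :
    TupleMultiplicative (fun n : Fin r → ℕ => (tauStar (∏ i, n i) : ℝ)) := by
  intro m n h
  simp only [Pi.mul_apply, prod_mul_distrib]
  rw [tauStar, cardDistinctFactors_mul h, pow_add, Nat.cast_mul]
  rfl

lemma tauStarCoeff_tupleMultiplicative {r : ℕ} :
    TupleMultiplicative (tauStarCoeff : (Fin r → ℕ) → ℝ) := by
  have hμ : (moebius : ArithmeticFunction ℝ).IsMultiplicative := isMultiplicative_moebius.intCast
  exact tauStar_tupleMultiplicative.tupleConv (hμ.mul hμ)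

lemma tauStarCoeff_eq_zero {r : ℕ} {d : Fin r → ℕ} {i : Fin r} (hi : d i = 0) :
    tauStarCoeff d = 0 := tupleConv_eq_zero _ _ hi

lemma tauStar_eq_tupleConv {r : ℕ} {n : Fin r → ℕ} (hn : ∀ i, n i ≠ 0) :
    (tauStar (∏ i, n i) : ℝ) =
      tupleConv tauStarCoeff ((zeta : ArithmeticFunction ℝ) * zeta) n := by
  have h : ((moebius : ArithmeticFunction ℝ) * moebius) * (zeta * zeta) = 1 := by
    rw [mul_mul_mul_comm, coe_moebius_mul_coe_zeta, one_mul]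
  have : (tauStarCoeff : (Fin r → ℕ) → ℝ) = tupleConv (fun n => (tauStar (∏ i, n i) : ℝ))
    ((moebius : ArithmeticFunction ℝ) * moebius) := rfl
  rw [this, tupleConv_assoc, h, tupleConv_one _ hn]

lemma localCoeff_eq_zero {r : ℕ} {e : Fin r → ℕ} {i : Fin r} (hi : 3 ≤ e i) :
    localCoeff e = 0 := by
  have h1 : localMoebius (e i) = 0 := by
    rw [localMoebius, if_neg (by omega), if_neg (by omega)]
  have h2 : localMoebiusSq (e i) = 0 := by
    rw [localMoebiusSq, if_neg (by omega), if_neg (by omega), if_neg (by omega)]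
  rw [localCoeff, prod_eq_zero (mem_univ i) h1, prod_eq_zero (mem_univ i) h2]
  norm_num

lemma localCoeff_eq_zero_of_sum_eq_one {r : ℕ} {e : Fin r → ℕ} (he : ∑ i, e i = 1) :
    localCoeff e = 0 := by
  have hle : ∀ i, e i ≤ 1 := fun i => he ▸ single_le_sum (fun _ _ => Nat.zero_le _) (mem_univ i)
  have h1 : ∀ i, localMoebius (e i) = (-1) ^ e i := fun i => by
    have := hle i
    interval_cases e i <;> norm_num [localMoebius]
  have h2 : ∀ i, localMoebiusSq (e i) = (-2) ^ e i := fun i => by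
    have := hle i
    interval_cases e i <;> norm_num [localMoebiusSq]
  simp only [localCoeff, h1, h2, prod_pow_eq_pow_sum, he]
  norm_num

lemma localCoeff_zero {r : ℕ} : localCoeff (0 : Fin r → ℕ) = 1 := by
  norm_num [localCoeff, localMoebius, localMoebiusSq]

lemma tupleSum_prime_pow {r : ℕ} {F c : (Fin r → ℕ) → ℝ} {p : ℕ} (hp : p.Prime)
    (hF : ∀ e : Fin r → ℕ, F (fun i => p ^ e i) = c e)
    (hc : ∀ (e : Fin r → ℕ) i, 3 ≤ e i → c e = 0) (k : ℕ) :
    tupleSum F (p ^ k) =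
      ∑ a ∈ Fintype.piFinset (fun _ : Fin r => range 3) with ∑ i, a i = k, c a := by
  symm
  refine sum_of_injOn (fun a i => p ^ a i) ?_ ?_ ?_ ?_
  · intro a _ b _ hab
    exact funext fun i => Nat.pow_right_injective hp.two_le (congrFun hab i)
  · intro a ha
    simp only [coe_filter, Set.mem_ofPred_eq] at ha
    simp only [mem_coe, Nat.mem_finMulAntidiag]
    exact ⟨by rw [prod_pow_eq_pow_sum, ha.2], (pow_pos hp.pos _).ne'⟩
  · intro d hd hn
    have hd' : ∀ i, ∃ k, d i = p ^ k := fun i => by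
      obtain ⟨k, -, hk⟩ := (Nat.dvd_prime_pow hp).mp (Nat.dvd_of_mem_finMulAntidiag hd i)
      exact ⟨k, hk⟩
    choose a ha using hd'
    have hda : d = fun i => p ^ a i := funext ha
    have hsum : ∑ i, a i = k := by
      have := Nat.prod_eq_of_mem_finMulAntidiag hd
      simp only [hda, prod_pow_eq_pow_sum] at this
      exact Nat.pow_right_injective hp.two_le this
    by_contra hne
    refine hn ⟨a, ?_, hda.symm⟩
    simp only [coe_filter, Set.mem_ofPred_eq, Fintype.mem_piFinset, mem_range]
    refine ⟨fun i => ?_, hsum⟩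
    by_contra! h3
    exact hne (by rw [hda, hF, hc a i h3])
  · intro a _
    exact (hF a).symm

/-- A bound for the sums of `|tauStarCoeff|` over tuples whose product is a given prime power. -/
noncomputable def localBound (r : ℕ) : ℝ :=
  ∑ a ∈ Fintype.piFinset (fun _ : Fin r => range 3), |localCoeff a|

lemma tupleSum_abs_prime_pow {r p : ℕ} (hp : p.Prime) (k : ℕ) :
    tupleSum (fun d : Fin r → ℕ => |tauStarCoeff d|) (p ^ k) =
      ∑ a ∈ Fintype.piFinset (fun _ : Fin r => range 3) with ∑ i, a i = k, |localCoeff a| :=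
  tupleSum_prime_pow hp (fun e => by rw [tauStarCoeff_prime_pow hp])
    (fun e i hi => by rw [localCoeff_eq_zero hi, abs_zero]) k

lemma tupleSum_abs_nonneg {r : ℕ} (k : ℕ) :
    0 ≤ tupleSum (fun d : Fin r → ℕ => |tauStarCoeff d|) k :=
  sum_nonneg fun _ _ => abs_nonneg _

lemma tupleSum_abs_prime_pow_le {r p : ℕ} (hp : p.Prime) (k : ℕ) :
    tupleSum (fun d : Fin r → ℕ => |tauStarCoeff d|) (p ^ k) ≤ localBound r := by
  rw [tupleSum_abs_prime_pow hp]
  exact sum_le_sum_of_subset_of_nonneg (filter_subset _ _) fun _ _ _ => abs_nonneg _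

lemma tupleSum_abs_prime_pow_eq_zero {r p : ℕ} (hp : p.Prime) {k : ℕ} (hk : 2 * r < k) :
    tupleSum (fun d : Fin r → ℕ => |tauStarCoeff d|) (p ^ k) = 0 := by
  rw [tupleSum_abs_prime_pow hp]
  refine sum_eq_zero fun a ha => ?_
  simp only [mem_filter, Fintype.mem_piFinset, mem_range] at ha
  have : ∑ i, a i ≤ ∑ _i : Fin r, 2 := sum_le_sum fun i _ => Nat.lt_succ_iff.mp (ha.1 i)
  simp only [sum_const, card_univ, Fintype.card_fin, smul_eq_mul] at this
  omega

lemma tupleSum_abs_prime {r p : ℕ} (hp : p.Prime) :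
    tupleSum (fun d : Fin r → ℕ => |tauStarCoeff d|) (p ^ 1) = 0 := by
  rw [tupleSum_abs_prime_pow hp]
  refine sum_eq_zero fun a ha => ?_
  rw [localCoeff_eq_zero_of_sum_eq_one (mem_filter.mp ha).2, abs_zero]

lemma tauStarCoeff_one {r : ℕ} : tauStarCoeff (1 : Fin r → ℕ) = 1 := by
  have := tauStarCoeff_prime_pow (r := r) Nat.prime_two 0
  rw [localCoeff_zero] at this
  rw [← this]
  congr 1

lemma tupleSum_abs_one {r : ℕ} :
    tupleSum (fun d : Fin r → ℕ => |tauStarCoeff d|) 1 = 1 := by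
  rw [tupleSum_one, tauStarCoeff_one, abs_one]

lemma tauStarCoeff_abs_tupleMultiplicative {r : ℕ} :
    TupleMultiplicative (fun d : Fin r → ℕ => |tauStarCoeff d|) := by
  intro m n h
  simp only [tauStarCoeff_tupleMultiplicative m n h, abs_mul]

end

section

open Finset

lemma summable_of_multiplicative_of_nonneg {f b : ℕ → ℝ} (hf0 : f 0 = 0) (hf1 : f 1 = 1)
    (hmul : ∀ {m n}, Nat.Coprime m n → f (m * n) = f m * f n) (hf : ∀ n, 0 ≤ f n)
    (hsum : ∀ {p : ℕ}, p.Prime → Summable fun e : ℕ => f (p ^ e))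
    (hle : ∀ {p : ℕ}, p.Prime → ∑' e : ℕ, f (p ^ e) ≤ 1 + b p)
    (hb0 : ∀ n, 0 ≤ b n) (hb : Summable b) : Summable f := by
  refine summable_of_sum_range_le (c := Real.exp (∑' n, b n)) hf fun N => ?_
  obtain ⟨hs, hS⟩ := EulerProduct.summable_and_hasSum_smoothNumbers_prod_primesBelow_tsum hf1 hmul
    (fun hp => by simpa only [Real.norm_of_nonneg (hf _)] using hsum hp) N
  have h1 : ∑ i ∈ range N, f i ≤ ∑' m : N.smoothNumbers, f m := by
    rw [_root_.tsum_subtype]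
    have hs' : Summable (Set.indicator (N.smoothNumbers) f) :=
      (summable_subtype_iff_indicator).mp hS.summable
    refine le_trans (sum_le_sum fun i hi => ?_)
      (hs'.sum_le_tsum (range N) fun i _ => Set.indicator_nonneg (fun i _ => hf i) i)
    rcases eq_or_ne i 0 with rfl | h0
    · rw [hf0]
      exact Set.indicator_nonneg (fun i _ => hf i) 0
    · rw [Set.indicator_of_mem
        (Nat.mem_smoothNumbers_of_lt (Nat.pos_of_ne_zero h0) (mem_range.mp hi))]
  refine h1.trans ?_
  rw [hS.tsum_eq]
  calc ∏ p ∈ N.primesBelow, ∑' n : ℕ, f (p ^ n)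
      ≤ ∏ p ∈ N.primesBelow, Real.exp (b p) := by
        refine prod_le_prod (fun p _ => tsum_nonneg fun _ => hf _) fun p hp => ?_
        refine (hle (Nat.prime_of_mem_primesBelow hp)).trans ?_
        rw [add_comm]
        exact Real.add_one_le_exp _
    _ = Real.exp (∑ p ∈ N.primesBelow, b p) := (Real.exp_sum _ _).symm
    _ ≤ Real.exp (∑' n, b n) := Real.exp_le_exp.mpr (hb.sum_le_tsum _ fun i _ => hb0 i)

lemma localBound_nonneg (r : ℕ) : 0 ≤ localBound r := sum_nonneg fun _ _ => abs_nonneg _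

lemma summable_tupleSum_abs (r : ℕ) {σ : ℝ} (hσ : 1 / 2 < σ) :
    Summable fun k : ℕ => tupleSum (fun d : Fin r → ℕ => |tauStarCoeff d|) k * (k : ℝ) ^ (-σ) := by
  set t := tupleSum (fun d : Fin r → ℕ => |tauStarCoeff d|) with ht
  have hz : ∀ {p : ℕ}, p.Prime → ∀ e ∉ range (2 * r + 1),
      t (p ^ e) * ((p ^ e : ℕ) : ℝ) ^ (-σ) = 0 := fun hp e he => by
    rw [ht, tupleSum_abs_prime_pow_eq_zero hp (by simpa using he), zero_mul]
  refine summable_of_multiplicative_of_nonneg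
    (b := fun p => (2 * r : ℕ) * (localBound r * (p : ℝ) ^ (-(2 * σ)))) ?_ ?_ ?_ ?_ ?_ ?_ ?_ ?_
  · rw [ht, tupleSum_zero, zero_mul]
  · rw [ht, tupleSum_abs_one, Nat.cast_one, Real.one_rpow, one_mul]
  · intro m n h
    rw [ht, tupleSum_mul tauStarCoeff_abs_tupleMultiplicative h, Nat.cast_mul,
      Real.mul_rpow (Nat.cast_nonneg _) (Nat.cast_nonneg _)]
    ring
  · exact fun n => mul_nonneg (tupleSum_abs_nonneg n) (Real.rpow_nonneg (Nat.cast_nonneg _) _)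
  · exact fun hp => summable_of_ne_finset_zero (hz hp)
  · intro p hp
    rw [tsum_eq_sum (hz hp), sum_range_succ', pow_zero, ht, tupleSum_abs_one, Nat.cast_one,
      Real.one_rpow, mul_one, add_comm]
    refine add_le_add_right ?_ 1
    refine (sum_le_card_nsmul _ _ (localBound r * (p : ℝ) ^ (-(2 * σ))) fun e _ => ?_).trans
      (by rw [card_range, nsmul_eq_mul])
    have hp1 : (1 : ℝ) ≤ p := by exact_mod_cast hp.one_le
    rcases Nat.eq_zero_or_pos e with rfl | he
    · rw [zero_add, tupleSum_abs_prime hp, zero_mul]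
      exact mul_nonneg (localBound_nonneg r) (Real.rpow_nonneg (Nat.cast_nonneg _) _)
    · refine mul_le_mul (tupleSum_abs_prime_pow_le hp _) ?_
        (Real.rpow_nonneg (Nat.cast_nonneg _) _) (localBound_nonneg r)
      rw [Nat.cast_pow, ← Real.rpow_natCast, ← Real.rpow_mul (by linarith)]
      refine Real.rpow_le_rpow_of_exponent_le hp1 ?_
      have : (2 : ℝ) ≤ ((e + 1 : ℕ) : ℝ) := by exact_mod_cast Nat.succ_le_succ he
      nlinarith
  · exact fun n => mul_nonneg (Nat.cast_nonneg _)
      (mul_nonneg (localBound_nonneg r) (Real.rpow_nonneg (Nat.cast_nonneg _) _))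
  · exact ((Real.summable_nat_rpow.mpr (by linarith)).mul_left _).mul_left _

lemma tauStarCoeff_eq_zero_of_prod {r : ℕ} {d : Fin r → ℕ} (h : ∏ i, d i = 0) :
    tauStarCoeff d = 0 := by
  obtain ⟨i, -, hi⟩ := Finset.prod_eq_zero_iff.mp h
  exact tauStarCoeff_eq_zero hi

lemma summable_tauStarCoeff (r : ℕ) {σ : ℝ} (hσ : 1 / 2 < σ) :
    Summable fun d : Fin r → ℕ => |tauStarCoeff d| * ∏ i, (d i : ℝ) ^ (-σ) := by
  have hw : ∀ d : Fin r → ℕ, ∏ i, (d i : ℝ) ^ (-σ) = ((∏ i, d i : ℕ) : ℝ) ^ (-σ) := fun d => by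
    rw [Nat.cast_prod, Real.finsetProd_rpow _ _ fun i _ => Nat.cast_nonneg _]
  simp only [hw]
  have hs := summable_tupleSum_abs r hσ
  have hnn : ∀ d : Fin r → ℕ, 0 ≤ |tauStarCoeff d| * ((∏ i, d i : ℕ) : ℝ) ^ (-σ) := fun d =>
    mul_nonneg (abs_nonneg _) (Real.rpow_nonneg (Nat.cast_nonneg _) _)
  refine summable_of_sum_le (c := ∑' k : ℕ, tupleSum (fun d : Fin r → ℕ => |tauStarCoeff d|) k *
    (k : ℝ) ^ (-σ)) hnn fun u => ?_
  have hfib := sum_fiberwise_of_maps_to (s := u) (t := u.image fun d => ∏ i, d i)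
    (g := fun d => ∏ i, d i) (fun d hd => mem_image_of_mem _ hd)
    (fun d : Fin r → ℕ => |tauStarCoeff d| * ((∏ i, d i : ℕ) : ℝ) ^ (-σ))
  have hle : ∀ k ∈ u.image fun d => ∏ i, d i,
      ∑ d ∈ u with ∏ i, d i = k, |tauStarCoeff d| * ((∏ i, d i : ℕ) : ℝ) ^ (-σ) ≤
      tupleSum (fun d : Fin r → ℕ => |tauStarCoeff d|) k * (k : ℝ) ^ (-σ) := by
    intro k _
    rcases eq_or_ne k 0 with rfl | hk
    · rw [tupleSum_zero, zero_mul]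
      refine (sum_eq_zero fun d hd => ?_).le
      rw [tauStarCoeff_eq_zero_of_prod (mem_filter.mp hd).2, abs_zero, zero_mul]
    · have hsub : {d ∈ u | ∏ i, d i = k} ⊆ Nat.finMulAntidiag r k := fun d hd =>
        Nat.mem_finMulAntidiag.mpr ⟨(mem_filter.mp hd).2, hk⟩
      rw [tupleSum, sum_mul]
      calc _ = ∑ d ∈ u with ∏ i, d i = k, |tauStarCoeff d| * (k : ℝ) ^ (-σ) :=
            sum_congr rfl fun d hd => by rw [(mem_filter.mp hd).2]
        _ ≤ _ := sum_le_sum_of_subset_of_nonneg hsub fun d _ _ =>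
            mul_nonneg (abs_nonneg _) (Real.rpow_nonneg (Nat.cast_nonneg _) _)
  rw [← hfib]
  exact (sum_le_sum hle).trans (hs.sum_le_tsum _ fun k _ =>
    mul_nonneg (tupleSum_abs_nonneg k) (Real.rpow_nonneg (Nat.cast_nonneg _) _))

lemma tsum_tupleSum {r : ℕ} {h : (Fin r → ℕ) → ℝ} (hs : Summable h)
    (h0 : ∀ d, ∏ i, d i = 0 → h d = 0) : ∑' k, tupleSum h k = ∑' d, h d := by
  have := hs.hasSum.tsum_fiberwise (fun d => ∏ i, d i)
  rw [← this.tsum_eq]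
  refine tsum_congr fun k => ?_
  rcases eq_or_ne k 0 with rfl | hk
  · rw [tupleSum_zero]
    have : ∀ b : ((fun d : Fin r → ℕ => ∏ i, d i) ⁻¹' {0}), h b = 0 := fun b => h0 _ b.2
    simp only [this, tsum_zero]
  · have e : ((fun d : Fin r → ℕ => ∏ i, d i) ⁻¹' {k}) = (Nat.finMulAntidiag r k : Set _) := by
      ext d
      simp [hk]
    rw [e, Finset.tsum_subtype']
    rfl

lemma sum_localCoeff {r : ℕ} (z : ℝ) :
    ∑ a ∈ Fintype.piFinset (fun _ : Fin r => range 3), localCoeff a * ∏ i, z ^ a i =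
      (1 - z) ^ r * (2 - (1 - z) ^ r) := by
  simp only [localCoeff, sub_mul, mul_assoc, ← prod_mul_distrib, sum_sub_distrib, ← mul_sum]
  rw [← prod_univ_sum (fun _ : Fin r => range 3) (fun _ j => localMoebius j * z ^ j),
    ← prod_univ_sum (fun _ : Fin r => range 3) (fun _ j => localMoebiusSq j * z ^ j)]
  simp only [prod_const, card_univ, Fintype.card_fin, sum_range_succ, range_zero, sum_empty]
  have h1 : 0 + localMoebius 0 * z ^ 0 + localMoebius 1 * z ^ 1 + localMoebius 2 * z ^ 2 = 1 - z := by
    norm_num [localMoebius]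
    ring
  have h2 : 0 + localMoebiusSq 0 * z ^ 0 + localMoebiusSq 1 * z ^ 1 + localMoebiusSq 2 * z ^ 2 =
      (1 - z) * (1 - z) := by
    norm_num [localMoebiusSq]
    ring
  rw [h1, h2, mul_pow]
  ring

/-- The factor at `p` of the leading coefficient. -/
noncomputable def eulerFactor (r p : ℕ) : ℝ := (1 - 1 / (p : ℝ)) ^ r * (2 - (1 - 1 / (p : ℝ)) ^ r)

lemma tsum_tupleSum_prime_pow {r p : ℕ} (hp : p.Prime) :
    ∑' e : ℕ, tupleSum (tauStarCoeff : (Fin r → ℕ) → ℝ) (p ^ e) * ((p ^ e : ℕ) : ℝ)⁻¹ =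
      eulerFactor r p := by
  have hmaps : ∀ a ∈ Fintype.piFinset (fun _ : Fin r => range 3),
      ∑ i, a i ∈ range (2 * r + 1) := by
    intro a ha
    simp only [Fintype.mem_piFinset, mem_range] at ha ⊢
    have : ∑ i, a i ≤ ∑ _i : Fin r, 2 := sum_le_sum fun i _ => Nat.lt_succ_iff.mp (ha i)
    simp only [sum_const, card_univ, Fintype.card_fin, smul_eq_mul] at this
    omega
  have hl : ∀ e, tupleSum (tauStarCoeff : (Fin r → ℕ) → ℝ) (p ^ e) =
      ∑ a ∈ Fintype.piFinset (fun _ : Fin r => range 3) with ∑ i, a i = e, localCoeff a :=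
    tupleSum_prime_pow hp (tauStarCoeff_prime_pow hp) fun e i hi => localCoeff_eq_zero hi
  rw [tsum_eq_sum (s := range (2 * r + 1)), eulerFactor, ← sum_localCoeff,
    ← sum_fiberwise_of_maps_to hmaps]
  · refine sum_congr rfl fun e _ => ?_
    rw [hl, sum_mul]
    refine sum_congr rfl fun a ha => ?_
    rw [prod_pow_eq_pow_sum, (mem_filter.mp ha).2, Nat.cast_pow, one_div, inv_pow]
  · intro e he
    rw [hl, filter_eq_empty_iff.mpr, sum_empty, zero_mul]
    rintro a ha rfl
    exact he (hmaps a ha)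

lemma summable_tauStarCoeff_inv (r : ℕ) :
    Summable fun d : Fin r → ℕ => tauStarCoeff d * ∏ i, (d i : ℝ)⁻¹ := by
  refine Summable.of_norm ((summable_tauStarCoeff r (σ := 1) (by norm_num)).congr fun d => ?_)
  rw [norm_mul, Real.norm_eq_abs, Real.norm_of_nonneg
    (prod_nonneg fun i _ => inv_nonneg.mpr (Nat.cast_nonneg _))]
  simp only [Real.rpow_neg_one]

lemma hasProd_eulerFactor (r : ℕ) :
    HasProd (fun p : Nat.Primes => eulerFactor r p)
      (∑' d : Fin r → ℕ, tauStarCoeff d * ∏ i, (d i : ℝ)⁻¹) := by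
  set f : ℕ → ℝ := fun k => tupleSum (tauStarCoeff : (Fin r → ℕ) → ℝ) k * (k : ℝ)⁻¹ with hf
  have hfs : Summable (‖f ·‖) := by
    refine Summable.of_nonneg_of_le (fun _ => norm_nonneg _) (fun k => ?_)
      (summable_tupleSum_abs r (σ := 1) (by norm_num))
    rw [norm_mul, norm_inv, Real.norm_natCast, Real.rpow_neg_one]
    exact mul_le_mul_of_nonneg_right (abs_sum_le_sum_abs _ _) (inv_nonneg.mpr (Nat.cast_nonneg _))
  have h := EulerProduct.eulerProduct_hasProd (f := f)
    (by simp only [hf, tupleSum_one, tauStarCoeff_one, Nat.cast_one, inv_one, mul_one])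
    (fun {m n} hmn => by
      simp only [hf, tupleSum_mul tauStarCoeff_tupleMultiplicative hmn, Nat.cast_mul, mul_inv]
      ring) hfs (by simp only [hf, tupleSum_zero, zero_mul])
  have e1 : (fun p : Nat.Primes => ∑' e, f ((p : ℕ) ^ e)) = fun p : Nat.Primes => eulerFactor r p :=
    funext fun p => tsum_tupleSum_prime_pow p.2
  have e2 : ∑' k, f k = ∑' d : Fin r → ℕ, tauStarCoeff d * ∏ i, (d i : ℝ)⁻¹ := by
    rw [← tsum_tupleSum (summable_tauStarCoeff_inv r) fun d hd => by
      rw [tauStarCoeff_eq_zero_of_prod hd, zero_mul]]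
    refine tsum_congr fun k => ?_
    simp only [hf, tupleSum, sum_mul]
    refine sum_congr rfl fun d hd => ?_
    rw [prod_inv_distrib, ← Nat.cast_prod, Nat.prod_eq_of_mem_finMulAntidiag hd]
  rwa [e1, e2] at h

lemma eulerFactor_eq (r p : ℕ) : eulerFactor r p = 1 + -(1 - (1 - 1 / (p : ℝ)) ^ r) ^ 2 := by
  rw [eulerFactor]
  ring

lemma tsum_tauStarCoeff_ne_zero (r : ℕ) :
    ∑' d : Fin r → ℕ, tauStarCoeff d * ∏ i, (d i : ℝ)⁻¹ ≠ 0 := by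
  rw [← (hasProd_eulerFactor r).tprod_eq]
  simp only [eulerFactor_eq]
  have hb : ∀ p : Nat.Primes, 0 < 1 - 1 / ((p : ℕ) : ℝ) ∧ 1 - 1 / ((p : ℕ) : ℝ) ≤ 1 := fun p => by
    have : (1 : ℝ) < (p : ℕ) := by exact_mod_cast p.2.one_lt
    have h1 : 1 / ((p : ℕ) : ℝ) < 1 := by rw [div_lt_one (by linarith)]; exact this
    have h2 : 0 < 1 / ((p : ℕ) : ℝ) := by positivity
    constructor <;> linarith
  refine tprod_one_add_ne_zero_of_summable (fun p => ?_) ?_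
  · rw [← eulerFactor_eq, eulerFactor]
    have h1 := pow_pos (hb p).1 r
    have h2 := pow_le_one₀ (n := r) (hb p).1.le (hb p).2
    exact (mul_pos h1 (by linarith)).ne'
  · have hs : Summable fun p : Nat.Primes => (r : ℝ) ^ 2 * ((p : ℕ) : ℝ) ^ (-2 : ℝ) :=
      (Nat.Primes.summable_rpow.mpr (by norm_num)).mul_left _
    refine Summable.of_nonneg_of_le (fun _ => norm_nonneg _) (fun p => ?_) hs
    have h2 := pow_le_one₀ (n := r) (hb p).1.le (hb p).2
    have h3 := one_add_mul_le_pow (a := -(1 / ((p : ℕ) : ℝ))) (by linarith [(hb p).1]) r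
    rw [norm_neg, norm_pow, Real.norm_of_nonneg (by linarith),
      Real.rpow_neg (Nat.cast_nonneg _), Real.rpow_ofNat, ← inv_pow, ← mul_pow]
    refine pow_le_pow_left₀ (by linarith) ?_ 2
    rw [← sub_eq_add_neg] at h3
    rw [← one_div]
    linarith

end

section

open Finset ArithmeticFunction

lemma sum_Ioc_div_eq_hyperbola (N : ℕ) :
    ∑ n ∈ Ioc 0 N, N / n + N.sqrt ^ 2 = 2 * ∑ a ∈ Ioc 0 N.sqrt, N / a := by
  set u := N.sqrt with hu
  have hu2 : u * u ≤ N := Nat.sqrt_le N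
  have huN : u ≤ N := Nat.sqrt_le_self N
  have hlt : N < (u + 1) * (u + 1) := Nat.lt_succ_sqrt N
  set S : Finset (ℕ × ℕ) := {x ∈ Ioc 0 N ×ˢ Ioc 0 N | x.1 * x.2 ≤ N} with hS
  set S₁ : Finset (ℕ × ℕ) := {x ∈ Ioc 0 u ×ˢ Ioc 0 N | x.1 * x.2 ≤ N} with hS₁
  set S₂ : Finset (ℕ × ℕ) := {x ∈ Ioc 0 N ×ˢ Ioc 0 u | x.1 * x.2 ≤ N} with hS₂
  have hfib : ∀ a, 0 < a → #{b ∈ Ioc 0 N | a * b ≤ N} = N / a := by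
    intro a ha
    have : {b ∈ Ioc 0 N | a * b ≤ N} = Ioc 0 (N / a) := by
      ext b
      simp only [mem_filter, mem_Ioc, Nat.le_div_iff_mul_le ha, mul_comm b a, and_assoc]
      refine and_congr_right fun _ => ⟨fun h => h.2, fun h => ⟨?_, h⟩⟩
      exact (Nat.le_mul_of_pos_left b ha).trans h
    rw [this, Nat.card_Ioc, Nat.sub_zero]
  have hcard : ∀ M, #{x ∈ Ioc 0 M ×ˢ Ioc 0 N | x.1 * x.2 ≤ N} = ∑ a ∈ Ioc 0 M, N / a := by
    intro M
    rw [card_filter, sum_product]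
    refine sum_congr rfl fun a ha => ?_
    rw [← card_filter, hfib a (mem_Ioc.mp ha).1]
  have h2 : #S₂ = #S₁ := by
    refine card_bij' (fun x _ => x.swap) (fun x _ => x.swap) ?_ ?_ (fun _ _ => rfl) (fun _ _ => rfl)
    · rintro ⟨a, b⟩ h
      simp only [hS₁, hS₂, mem_filter, mem_product, Prod.swap, mul_comm b a] at h ⊢
      tauto
    · rintro ⟨a, b⟩ h
      simp only [hS₁, hS₂, mem_filter, mem_product, Prod.swap, mul_comm b a] at h ⊢
      tauto
  have hunion : S₁ ∪ S₂ = S := by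
    ext ⟨a, b⟩
    simp only [hS, hS₁, hS₂, mem_union, mem_filter, mem_product, mem_Ioc]
    constructor
    · rintro (h | h)
      · exact ⟨⟨⟨h.1.1.1, h.1.1.2.trans huN⟩, h.1.2⟩, h.2⟩
      · exact ⟨⟨h.1.1, h.1.2.1, h.1.2.2.trans huN⟩, h.2⟩
    · rintro ⟨⟨h1, h2⟩, h⟩
      by_cases ha : a ≤ u
      · exact Or.inl ⟨⟨⟨h1.1, ha⟩, h2⟩, h⟩
      · refine Or.inr ⟨⟨h1, h2.1, ?_⟩, h⟩
        by_contra hb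
        have := Nat.mul_le_mul (show u + 1 ≤ a by omega) (show u + 1 ≤ b by omega)
        omega
  have hinter : S₁ ∩ S₂ = Ioc 0 u ×ˢ Ioc 0 u := by
    ext ⟨a, b⟩
    simp only [hS₁, hS₂, mem_inter, mem_filter, mem_product, mem_Ioc]
    constructor
    · rintro ⟨h, h'⟩
      exact ⟨h.1.1, h'.1.2⟩
    · rintro ⟨h, h'⟩
      have := (Nat.mul_le_mul h.2 h'.2).trans hu2
      exact ⟨⟨⟨h, h'.1, h'.2.trans huN⟩, this⟩, ⟨⟨h.1, h.2.trans huN⟩, h'⟩, this⟩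
  have key := card_union_add_card_inter S₁ S₂
  rw [hunion, hinter, h2, hS, hS₁, hcard, hcard, card_product, Nat.card_Ioc, Nat.sub_zero] at key
  rw [sq, key, two_mul]

/-- The summatory function of the divisor function. -/
noncomputable def divisorSum (y : ℝ) : ℝ :=
  ∑ m ∈ Ioc 0 ⌊y⌋₊, ((zeta : ArithmeticFunction ℝ) * zeta) m

/-- The main term in the Dirichlet divisor problem. -/
noncomputable def divisorMain (y : ℝ) : ℝ :=
  y * (Real.log y + (2 * Real.eulerMascheroniConstant - 1))

lemma divisorSum_eq (y : ℝ) :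
    divisorSum y = 2 * ∑ a ∈ Ioc 0 (⌊y⌋₊).sqrt, ((⌊y / a⌋₊ : ℕ) : ℝ) - (((⌊y⌋₊).sqrt : ℕ) : ℝ) ^ 2 := by
  have h := sum_Ioc_div_eq_hyperbola ⌊y⌋₊
  have h1 : divisorSum y = ((∑ n ∈ Ioc 0 ⌊y⌋₊, ⌊y⌋₊ / n : ℕ) : ℝ) := by
    rw [divisorSum, sum_Ioc_mul_zeta_eq_sum, Nat.cast_sum]
    refine sum_congr rfl fun n hn => ?_
    rw [natCoe_apply, zeta_apply_ne (mem_Ioc.mp hn).1.ne', Nat.cast_one, one_mul]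
  rw [h1, eq_sub_iff_add_eq]
  simp only [Nat.floor_div_natCast]
  exact_mod_cast h

lemma abs_harmonic_sub_le {u : ℕ} {s : ℝ} (hu : 0 < u) (h1 : (u : ℝ) ≤ s) (h2 : s < u + 1) :
    |∑ a ∈ Ioc 0 u, (a : ℝ)⁻¹ - (Real.log s + Real.eulerMascheroniConstant)| ≤ 1 / u := by
  have hu0 : (0 : ℝ) < u := by exact_mod_cast hu
  have hs0 : 0 < s := by linarith
  have hH : ∑ a ∈ Ioc 0 u, (a : ℝ)⁻¹ = ((harmonic u : ℚ) : ℝ) := by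
    rw [harmonic_eq_sum_Icc]
    push_cast
    rfl
  have e1 := Real.eulerMascheroniSeq_lt_eulerMascheroniConstant u
  have e2 := Real.eulerMascheroniConstant_lt_eulerMascheroniSeq' u
  rw [Real.eulerMascheroniSeq] at e1
  rw [Real.eulerMascheroniSeq', if_neg hu.ne'] at e2
  have l1 : Real.log (u + 1) - Real.log u ≤ 1 / u := by
    rw [← Real.log_div (by linarith) hu0.ne']
    refine (Real.log_le_sub_one_of_pos (by positivity)).trans (le_of_eq ?_)
    field_simp
    ring
  have l2 : Real.log s ≤ Real.log (u + 1) := Real.log_le_log hs0 h2.le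
  have l3 : Real.log u ≤ Real.log s := Real.log_le_log hu0 h1
  rw [hH, abs_le]
  constructor <;> linarith

lemma abs_divisorSum_sub_le_sqrt {y : ℝ} (hy : 1 ≤ y) :
    |divisorSum y - divisorMain y| ≤ 8 * Real.sqrt y := by
  set s := Real.sqrt y with hs
  set u := (⌊y⌋₊).sqrt with hu
  have hy0 : 0 ≤ y := by linarith
  have hss : s * s = y := Real.mul_self_sqrt hy0
  have hs1 : 1 ≤ s := Real.one_le_sqrt.mpr hy
  have hus : (u : ℝ) ≤ s := by
    refine Real.le_sqrt_of_sq_le ?_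
    rw [sq]
    exact le_trans (by exact_mod_cast Nat.sqrt_le _) (Nat.floor_le hy0)
  have hsu : s < u + 1 := by
    rw [hs, Real.sqrt_lt' (by positivity), sq]
    refine (Nat.lt_floor_add_one y).trans_le ?_
    exact_mod_cast Nat.lt_succ_sqrt ⌊y⌋₊
  have hu0 : 0 < u := by
    have : (0 : ℝ) < u := by linarith
    exact_mod_cast this
  have hu1 : (1 : ℝ) ≤ u := by exact_mod_cast hu0
  have hyu : y * (1 / u) ≤ 2 * s := by
    rw [mul_one_div, div_le_iff₀ (by linarith), ← hss]
    nlinarith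
  have hH := mul_le_mul_of_nonneg_left (abs_harmonic_sub_le hu0 hus hsu) hy0
  have hfl : |∑ a ∈ Ioc 0 u, ((⌊y / a⌋₊ : ℕ) : ℝ) - y * ∑ a ∈ Ioc 0 u, (a : ℝ)⁻¹| ≤ u := by
    rw [mul_sum, ← sum_sub_distrib]
    refine (abs_sum_le_sum_abs _ _).trans ((sum_le_card_nsmul _ _ 1 fun a _ => ?_).trans (by simp))
    have h0 : 0 ≤ y / a := div_nonneg hy0 (Nat.cast_nonneg _)
    rw [← div_eq_mul_inv, abs_le]
    constructor <;> linarith [Nat.floor_le h0, Nat.lt_floor_add_one (y / a)]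
  have hlog : Real.log y = 2 * Real.log s := by
    rw [← hss, Real.log_mul (by linarith) (by linarith)]
    ring
  rw [← abs_of_nonneg hy0, ← abs_mul, abs_of_nonneg hy0] at hH
  have hH' := hH.trans hyu
  rw [divisorSum_eq, divisorMain, ← hu, hlog]
  rw [abs_le] at hH' hfl ⊢
  constructor <;> nlinarith

lemma abs_divisorMain_le {y : ℝ} (hy : 0 < y) (hy1 : y ≤ 1) {δ : ℝ} (hδ : δ ≤ 1 / 4) :
    |divisorMain y| ≤ (4 + |2 * Real.eulerMascheroniConstant - 1|) * y ^ (1 / 2 + δ) := by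
  have h1 : y ^ (3 / 4 : ℝ) ≤ y ^ (1 / 2 + δ) :=
    Real.rpow_le_rpow_of_exponent_ge hy hy1 (by linarith)
  have h2 : y ≤ y ^ (1 / 2 + δ) := by
    nth_rewrite 1 [← Real.rpow_one y]
    exact Real.rpow_le_rpow_of_exponent_ge hy hy1 (by linarith)
  have h3 : y * |Real.log y| ≤ 4 * y ^ (3 / 4 : ℝ) := by
    have := Real.log_le_rpow_div (x := y⁻¹) (inv_nonneg.mpr hy.le) (ε := 1 / 4) (by norm_num)
    rw [Real.log_inv, Real.inv_rpow hy.le, ← Real.rpow_neg hy.le] at this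
    rw [abs_of_nonpos (Real.log_nonpos hy.le hy1)]
    refine (mul_le_mul_of_nonneg_left this hy.le).trans (le_of_eq ?_)
    have e : y ^ (3 / 4 : ℝ) = y * y ^ (-(1 / 4) : ℝ) := by
      nth_rewrite 2 [← Real.rpow_one y]
      rw [← Real.rpow_add hy]
      norm_num
    rw [e]
    ring
  rw [divisorMain, abs_mul, abs_of_pos hy]
  calc _ ≤ y * (|Real.log y| + |2 * Real.eulerMascheroniConstant - 1|) :=
        mul_le_mul_of_nonneg_left (abs_add_le _ _) hy.le
    _ = y * |Real.log y| + |2 * Real.eulerMascheroniConstant - 1| * y := by ring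
    _ ≤ 4 * y ^ (1 / 2 + δ) + |2 * Real.eulerMascheroniConstant - 1| * y ^ (1 / 2 + δ) :=
        add_le_add (h3.trans (by linarith)) (mul_le_mul_of_nonneg_left h2 (abs_nonneg _))
    _ = _ := by ring

lemma divisorSum_of_lt_one {y : ℝ} (hy : y < 1) : divisorSum y = 0 := by
  rw [divisorSum, Nat.floor_eq_zero.mpr hy, Ioc_self, sum_empty]

lemma abs_divisorSum_sub_divisorMain_le {y δ : ℝ} (hy : 0 < y) (hδ0 : 0 < δ) (hδ : δ ≤ 1 / 4) :
    |divisorSum y - divisorMain y| ≤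
      (8 + |2 * Real.eulerMascheroniConstant - 1|) * y ^ (1 / 2 + δ) := by
  have hpos := Real.rpow_nonneg hy.le (1 / 2 + δ)
  have habs := abs_nonneg (2 * Real.eulerMascheroniConstant - 1)
  rcases lt_or_ge y 1 with h | h
  · rw [divisorSum_of_lt_one h, zero_sub, abs_neg]
    refine (abs_divisorMain_le hy h.le hδ).trans ?_
    exact mul_le_mul_of_nonneg_right (by linarith) hpos
  · refine (abs_divisorSum_sub_le_sqrt h).trans ?_
    rw [Real.sqrt_eq_rpow]
    exact mul_le_mul (by linarith) (Real.rpow_le_rpow_of_exponent_le h (by linarith))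
      (Real.rpow_nonneg hy.le _) (by linarith)

end

section

open Finset

lemma tauStarSum_eq_tsum (r : ℕ) (x : ℝ) :
    (tauStarSum r x : ℝ) = ∑' d : Fin r → ℕ, tauStarCoeff d * ∏ i, divisorSum (x / d i) := by
  have h1 : (tauStarSum r x : ℝ) = ∑ n ∈ Fintype.piFinset (fun _ : Fin r => Icc 1 ⌊x⌋₊),
      tupleConv tauStarCoeff
        ((ArithmeticFunction.zeta : ArithmeticFunction ℝ) * ArithmeticFunction.zeta) n := by
    rw [tauStarSum, Nat.cast_sum]
    refine sum_congr rfl fun n hn => tauStar_eq_tupleConv fun i => ?_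
    have := (mem_Icc.mp (Fintype.mem_piFinset.mp hn i)).1
    omega
  rw [h1, sum_tupleConv, tsum_eq_sum (s := Fintype.piFinset (fun _ : Fin r => Icc 1 ⌊x⌋₊))]
  · simp only [divisorSum, Nat.floor_div_natCast]
  · intro d hd
    rw [Fintype.mem_piFinset] at hd
    push Not at hd
    obtain ⟨i, hi⟩ := hd
    rw [mem_Icc, not_and_or] at hi
    rcases Nat.eq_zero_or_pos (d i) with h0 | h0
    · rw [tauStarCoeff_eq_zero h0, zero_mul]
    · have hlt : ⌊x⌋₊ < d i := by omega
      have hz : divisorSum (x / d i) = 0 := by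
        rw [divisorSum, Nat.floor_div_natCast, Nat.div_eq_of_lt hlt, Ioc_self, sum_empty]
      rw [prod_eq_zero (f := fun i => divisorSum (x / d i)) (mem_univ i) hz, mul_zero]

lemma abs_prod_sub_prod_le {ι : Type*} (s : Finset ι) {a b A : ι → ℝ} {η : ℝ} (hη : 0 ≤ η)
    (ha : ∀ i ∈ s, |a i| ≤ A i) (hb : ∀ i ∈ s, |b i| ≤ A i)
    (hab : ∀ i ∈ s, |a i - b i| ≤ η * A i) :
    |∏ i ∈ s, a i - ∏ i ∈ s, b i| ≤ #s * η * ∏ i ∈ s, A i := by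
  classical
  induction s using Finset.induction_on with
  | empty => simp
  | insert j s hj ih =>
    have ih' := ih (fun i hi => ha i (mem_insert_of_mem hi)) (fun i hi => hb i (mem_insert_of_mem hi))
      (fun i hi => hab i (mem_insert_of_mem hi))
    have hA : ∀ i ∈ s, 0 ≤ A i := fun i hi => (abs_nonneg _).trans (ha i (mem_insert_of_mem hi))
    have hbp : |∏ i ∈ s, b i| ≤ ∏ i ∈ s, A i := by
      rw [abs_prod]
      exact prod_le_prod (fun _ _ => abs_nonneg _) fun i hi => hb i (mem_insert_of_mem hi)
    have haj := ha j (mem_insert_self _ _)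
    have habj := hab j (mem_insert_self _ _)
    have hAj : 0 ≤ A j := (abs_nonneg _).trans haj
    rw [prod_insert hj, prod_insert hj, prod_insert hj, card_insert_of_notMem hj]
    have e : a j * ∏ i ∈ s, a i - b j * ∏ i ∈ s, b i =
        a j * (∏ i ∈ s, a i - ∏ i ∈ s, b i) + (a j - b j) * ∏ i ∈ s, b i := by ring
    rw [e]
    refine (abs_add_le _ _).trans ?_
    rw [abs_mul, abs_mul]
    refine (add_le_add (mul_le_mul haj ih' (abs_nonneg _) hAj)
      (mul_le_mul habj hbp (abs_nonneg _) (mul_nonneg hη hAj))).trans (le_of_eq ?_)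
    push_cast
    ring

/-- The constant `2γ - 1`. -/
noncomputable def divisorConst : ℝ := 2 * Real.eulerMascheroniConstant - 1

lemma abs_divisorMain_div_le {x δ : ℝ} (hx : 1 ≤ x) (hδ0 : 0 < δ) (hδ : δ ≤ 1 / 4) {d : ℕ}
    (hd : d ≠ 0) : |divisorMain (x / d)| ≤
      (2 / δ + |divisorConst|) * (x ^ (1 + δ) * (d : ℝ) ^ (-(1 / 2 + δ))) := by
  have hd1 : (1 : ℝ) ≤ d := by exact_mod_cast Nat.one_le_iff_ne_zero.mpr hd
  have hx0 : 0 < x := by linarith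
  have hd0 : (0 : ℝ) < d := by linarith
  have hxδ : 1 ≤ x ^ δ := Real.one_le_rpow hx hδ0.le
  have hdδ : 1 ≤ (d : ℝ) ^ δ := Real.one_le_rpow hd1 hδ0.le
  have lx : Real.log x ≤ x ^ δ / δ := Real.log_le_rpow_div hx0.le hδ0
  have ld : Real.log d ≤ (d : ℝ) ^ δ / δ := Real.log_le_rpow_div hd0.le hδ0
  have hc := abs_nonneg divisorConst
  have h1 : |Real.log (x / d) + divisorConst| ≤ (2 / δ + |divisorConst|) * (x ^ δ * (d : ℝ) ^ δ) := by
    refine (abs_add_le _ _).trans ?_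
    rw [Real.log_div hx0.ne' hd0.ne']
    have a1 : |Real.log x - Real.log d| ≤ x ^ δ / δ + (d : ℝ) ^ δ / δ := by
      rw [abs_le]
      constructor <;> linarith [Real.log_nonneg hx, Real.log_nonneg hd1]
    have m1 : x ^ δ ≤ x ^ δ * (d : ℝ) ^ δ := le_mul_of_one_le_right (by linarith) hdδ
    have m2 : (d : ℝ) ^ δ ≤ x ^ δ * (d : ℝ) ^ δ := le_mul_of_one_le_left (by linarith) hxδ
    have m3 : x ^ δ / δ + (d : ℝ) ^ δ / δ ≤ 2 / δ * (x ^ δ * (d : ℝ) ^ δ) := by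
      rw [← add_div, div_mul_eq_mul_div]
      exact div_le_div_of_nonneg_right (by linarith) hδ0.le
    have m4 : |divisorConst| ≤ |divisorConst| * (x ^ δ * (d : ℝ) ^ δ) :=
      le_mul_of_one_le_right hc (by linarith)
    linarith
  have h2 : x / d * (x ^ δ * (d : ℝ) ^ δ) ≤ x ^ (1 + δ) * (d : ℝ) ^ (-(1 / 2 + δ)) := by
    have e1 : x / d * (x ^ δ * (d : ℝ) ^ δ) = x ^ (1 + δ) * (d : ℝ) ^ (-1 + δ) := by
      rw [Real.rpow_add hx0, Real.rpow_add hd0, Real.rpow_one, Real.rpow_neg_one]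
      ring
    rw [e1]
    exact mul_le_mul_of_nonneg_left (Real.rpow_le_rpow_of_exponent_le hd1 (by linarith))
      (Real.rpow_nonneg hx0.le _)
  rw [divisorMain, abs_mul, abs_of_pos (div_pos hx0 hd0)]
  refine (mul_le_mul_of_nonneg_left h1 (div_pos hx0 hd0).le).trans ?_
  rw [mul_left_comm]
  exact mul_le_mul_of_nonneg_left h2 (by positivity)

/-- A constant for the bounds on `divisorSum` and `divisorMain`. -/
noncomputable def divisorBound (δ : ℝ) : ℝ := 2 / δ + 8 + 2 * |divisorConst|

lemma divisor_bounds {x δ : ℝ} (hx : 1 ≤ x) (hδ0 : 0 < δ) (hδ : δ ≤ 1 / 4) {d : ℕ}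
    (hd : d ≠ 0) :
    |divisorSum (x / d)| ≤ divisorBound δ * (x ^ (1 + δ) * (d : ℝ) ^ (-(1 / 2 + δ))) ∧
    |divisorMain (x / d)| ≤ divisorBound δ * (x ^ (1 + δ) * (d : ℝ) ^ (-(1 / 2 + δ))) ∧
    |divisorSum (x / d) - divisorMain (x / d)| ≤
      x ^ (-(1 / 2) : ℝ) * (divisorBound δ * (x ^ (1 + δ) * (d : ℝ) ^ (-(1 / 2 + δ)))) := by
  have hx0 : 0 < x := by linarith
  have hd0 : (0 : ℝ) < d := by exact_mod_cast Nat.pos_of_ne_zero hd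
  have hM := abs_divisorMain_div_le hx hδ0 hδ hd
  have hE := abs_divisorSum_sub_divisorMain_le (div_pos hx0 hd0) hδ0 hδ
  have hc : 0 ≤ |divisorConst| := abs_nonneg _
  have hc' : |2 * Real.eulerMascheroniConstant - 1| = |divisorConst| := rfl
  set W := x ^ (1 + δ) * (d : ℝ) ^ (-(1 / 2 + δ)) with hW
  have hW0 : 0 ≤ W := by positivity
  have hη0 : 0 ≤ x ^ (-(1 / 2) : ℝ) := by positivity
  have hη1 : x ^ (-(1 / 2) : ℝ) ≤ 1 := Real.rpow_le_one_of_one_le_of_nonpos hx (by norm_num)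
  have e : (x / d) ^ (1 / 2 + δ) = x ^ (-(1 / 2) : ℝ) * W := by
    rw [hW, Real.div_rpow hx0.le hd0.le, Real.rpow_neg hd0.le, ← mul_assoc, ← Real.rpow_add hx0,
      div_eq_mul_inv]
    congr 2
    ring
  rw [e, hc'] at hE
  have hδ2 : 0 < 2 / δ := by positivity
  have hE1 : (8 + |divisorConst|) * (x ^ (-(1 / 2) : ℝ) * W) ≤ (8 + |divisorConst|) * W :=
    mul_le_mul_of_nonneg_left (mul_le_of_le_one_left hW0 hη1) (by linarith)
  refine ⟨?_, ?_, ?_⟩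
  · have : |divisorSum (x / d)| ≤ |divisorSum (x / d) - divisorMain (x / d)| +
        |divisorMain (x / d)| := by
      simpa using abs_add_le (divisorSum (x / d) - divisorMain (x / d)) (divisorMain (x / d))
    refine this.trans ((add_le_add (hE.trans hE1) hM).trans (le_of_eq ?_))
    rw [divisorBound]
    ring
  · exact hM.trans (mul_le_mul_of_nonneg_right (by rw [divisorBound]; linarith) hW0)
  · refine hE.trans ?_
    rw [mul_left_comm]
    refine mul_le_mul_of_nonneg_left ?_ hη0
    exact mul_le_mul_of_nonneg_right (by rw [divisorBound]; linarith) hW0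

lemma abs_tauStarCoeff_mul_le {r : ℕ} {d : Fin r → ℕ} {a b : ℝ}
    (h : (∀ i, d i ≠ 0) → |a| ≤ b) : |tauStarCoeff d * a| ≤ |tauStarCoeff d| * b := by
  by_cases hd : ∀ i, d i ≠ 0
  · rw [abs_mul]
    exact mul_le_mul_of_nonneg_left (h hd) (abs_nonneg _)
  · push Not at hd
    obtain ⟨i, hi⟩ := hd
    simp [tauStarCoeff_eq_zero hi]

lemma prod_divisor_bound {r : ℕ} (d : Fin r → ℕ) (x δ : ℝ) :
    ∏ i, (divisorBound δ * (x ^ (1 + δ) * (d i : ℝ) ^ (-(1 / 2 + δ)))) =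
      (divisorBound δ * x ^ (1 + δ)) ^ r * ∏ i, (d i : ℝ) ^ (-(1 / 2 + δ)) := by
  simp only [← mul_assoc, prod_mul_distrib, prod_const, card_univ, Fintype.card_fin, mul_pow]

lemma summable_tauStarCoeff_mul {r : ℕ} {a : (Fin r → ℕ) → ℝ} {σ B : ℝ} (hσ : 1 / 2 < σ)
    (h : ∀ d, (∀ i, d i ≠ 0) → |a d| ≤ B * ∏ i, (d i : ℝ) ^ (-σ)) :
    Summable fun d => tauStarCoeff d * a d := by
  refine Summable.of_norm_bounded ((summable_tauStarCoeff r hσ).mul_left B) fun d => ?_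
  rw [Real.norm_eq_abs, mul_left_comm]
  exact abs_tauStarCoeff_mul_le (h d)

lemma summable_divisorMain {r : ℕ} {x : ℝ} (hx : 1 ≤ x) :
    Summable fun d : Fin r → ℕ => tauStarCoeff d * ∏ i, divisorMain (x / d i) := by
  refine summable_tauStarCoeff_mul (σ := 1 / 2 + 1 / 4) (B := (divisorBound (1 / 4) *
    x ^ (1 + 1 / 4 : ℝ)) ^ r) (by norm_num) fun d hd => ?_
  rw [abs_prod, ← prod_divisor_bound]
  exact prod_le_prod (fun _ _ => abs_nonneg _) fun i _ =>
    (divisor_bounds hx (by norm_num) le_rfl (hd i)).2.1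

lemma summable_divisorSum {r : ℕ} {x : ℝ} (hx : 1 ≤ x) :
    Summable fun d : Fin r → ℕ => tauStarCoeff d * ∏ i, divisorSum (x / d i) := by
  refine summable_tauStarCoeff_mul (σ := 1 / 2 + 1 / 4) (B := (divisorBound (1 / 4) *
    x ^ (1 + 1 / 4 : ℝ)) ^ r) (by norm_num) fun d hd => ?_
  rw [abs_prod, ← prod_divisor_bound]
  exact prod_le_prod (fun _ _ => abs_nonneg _) fun i _ =>
    (divisor_bounds hx (by norm_num) le_rfl (hd i)).1

lemma abs_tauStarSum_sub_le (r : ℕ) {δ : ℝ} (hδ0 : 0 < δ) (hδ : δ ≤ 1 / 4) :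
    ∃ C : ℝ, ∀ x : ℝ, 1 ≤ x →
      |(tauStarSum r x : ℝ) - ∑' d : Fin r → ℕ, tauStarCoeff d * ∏ i, divisorMain (x / d i)| ≤
        C * x ^ ((r : ℝ) - 1 / 2 + r * δ) := by
  have hσ : 1 / 2 < 1 / 2 + δ := by linarith
  refine ⟨r * divisorBound δ ^ r *
    ∑' d : Fin r → ℕ, |tauStarCoeff d| * ∏ i, (d i : ℝ) ^ (-(1 / 2 + δ)), fun x hx => ?_⟩
  have hx0 : 0 < x := by linarith
  rw [tauStarSum_eq_tsum, ← (summable_divisorSum hx).tsum_sub (summable_divisorMain hx)]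
  have hs := (summable_tauStarCoeff r hσ).mul_left
    (r * x ^ (-(1 / 2) : ℝ) * (divisorBound δ * x ^ (1 + δ)) ^ r)
  rw [← Real.norm_eq_abs]
  refine (tsum_of_norm_bounded hs.hasSum fun d => ?_).trans (le_of_eq ?_)
  · rw [← mul_sub, Real.norm_eq_abs, mul_left_comm, mul_assoc, ← prod_divisor_bound]
    refine abs_tauStarCoeff_mul_le fun hd => ?_
    have := abs_prod_sub_prod_le (univ : Finset (Fin r)) (Real.rpow_nonneg hx0.le (-(1 / 2)))
      (fun i _ => (divisor_bounds hx hδ0 hδ (hd i)).1)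
      (fun i _ => (divisor_bounds hx hδ0 hδ (hd i)).2.1)
      (fun i _ => (divisor_bounds hx hδ0 hδ (hd i)).2.2)
    rwa [card_univ, Fintype.card_fin] at this
  · rw [tsum_mul_left, mul_pow, ← Real.rpow_natCast (x ^ (1 + δ)), ← Real.rpow_mul hx0.le]
    have : x ^ ((r : ℝ) - 1 / 2 + r * δ) = x ^ (-(1 / 2) : ℝ) * x ^ ((1 + δ) * r) := by
      rw [← Real.rpow_add hx0]
      congr 1
      ring
    rw [this]
    ring

/-- The coefficient of `(log x) ^ #S` in the main term coming from a set `S` of coordinates. -/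
noncomputable def mainCoeff {r : ℕ} (S : Finset (Fin r)) : ℝ :=
  ∑' d : Fin r → ℕ, tauStarCoeff d *
    ((∏ i, (d i : ℝ)⁻¹) * ∏ i ∈ univ \ S, (divisorConst - Real.log (d i)))

lemma summable_mainCoeff {r : ℕ} (S : Finset (Fin r)) :
    Summable fun d : Fin r → ℕ => tauStarCoeff d *
      ((∏ i, (d i : ℝ)⁻¹) * ∏ i ∈ univ \ S, (divisorConst - Real.log (d i))) := by
  have hB : 1 ≤ 4 + |divisorConst| := by linarith [abs_nonneg divisorConst]
  refine summable_tauStarCoeff_mul (σ := 3 / 4) (B := (4 + |divisorConst|) ^ r) (by norm_num)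
    fun d hd => ?_
  have hd1 : ∀ i, (1 : ℝ) ≤ d i := fun i => by exact_mod_cast Nat.one_le_iff_ne_zero.mpr (hd i)
  have hq : ∀ i, 1 ≤ (d i : ℝ) ^ (1 / 4 : ℝ) := fun i => Real.one_le_rpow (hd1 i) (by norm_num)
  have h1 : ∀ i, |divisorConst - Real.log (d i)| ≤
      (4 + |divisorConst|) * (d i : ℝ) ^ (1 / 4 : ℝ) := fun i => by
    have hl := Real.log_le_rpow_div (x := (d i : ℝ)) (Nat.cast_nonneg _) (ε := 1 / 4) (by norm_num)
    have hl0 := Real.log_nonneg (hd1 i)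
    have hc := le_mul_of_one_le_right (abs_nonneg divisorConst) (hq i)
    refine (abs_sub _ _).trans ?_
    rw [abs_of_nonneg hl0]
    linarith
  have h2 : |∏ i ∈ univ \ S, (divisorConst - Real.log (d i))| ≤
      ∏ i, ((4 + |divisorConst|) * (d i : ℝ) ^ (1 / 4 : ℝ)) := by
    rw [abs_prod]
    refine (prod_le_prod (fun _ _ => abs_nonneg _) fun i _ => h1 i).trans ?_
    have h1le : ∀ i, 1 ≤ (4 + |divisorConst|) * (d i : ℝ) ^ (1 / 4 : ℝ) := fun i =>
      one_le_mul_of_one_le_of_one_le hB (hq i)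
    exact prod_le_prod_of_subset_of_one_le (subset_univ _)
      (fun i _ => zero_le_one.trans (h1le i)) fun i _ _ => h1le i
  rw [abs_mul, abs_of_nonneg (prod_nonneg fun i _ => inv_nonneg.mpr (Nat.cast_nonneg _))]
  refine (mul_le_mul_of_nonneg_left h2 (prod_nonneg fun i _ =>
    inv_nonneg.mpr (Nat.cast_nonneg _))).trans (le_of_eq ?_)
  rw [prod_mul_distrib, prod_const, card_univ, Fintype.card_fin, mul_left_comm, ← prod_mul_distrib]
  congr 1
  refine prod_congr rfl fun i _ => ?_
  have hd0 : (0 : ℝ) < d i := by linarith [hd1 i]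
  rw [← Real.rpow_neg_one, ← Real.rpow_add hd0]
  norm_num

/-- The polynomial of the main term. -/
noncomputable def mainPoly (r : ℕ) : Polynomial ℝ :=
  ∑ S : Finset (Fin r), Polynomial.monomial #S (mainCoeff S)

lemma tsum_divisorMain (r : ℕ) {x : ℝ} (hx : 0 < x) :
    ∑' d : Fin r → ℕ, tauStarCoeff d * ∏ i, divisorMain (x / d i) =
      x ^ r * (mainPoly r).eval (Real.log x) := by
  simp only [mainPoly, Polynomial.eval_finsetSum, Polynomial.eval_monomial, mainCoeff]
  have hS : ∀ S : Finset (Fin r), Summable fun d : Fin r → ℕ => tauStarCoeff d *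
      ((∏ i, (d i : ℝ)⁻¹) * ∏ i ∈ univ \ S, (divisorConst - Real.log (d i))) *
        Real.log x ^ #S := fun S => (summable_mainCoeff S).mul_right _
  simp only [← tsum_mul_right]
  rw [← Summable.tsum_finsetSum fun S _ => hS S, ← tsum_mul_left]
  refine tsum_congr fun d => ?_
  by_cases hd : ∀ i, d i ≠ 0
  · have h1 : ∀ i, divisorMain (x / d i) =
        x * (d i : ℝ)⁻¹ * (Real.log x + (divisorConst - Real.log (d i))) := fun i => by
      rw [divisorMain, Real.log_div hx.ne' (Nat.cast_ne_zero.mpr (hd i)), div_eq_mul_inv,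
        divisorConst]
      ring
    simp only [h1, prod_mul_distrib, prod_const, card_univ, Fintype.card_fin]
    rw [prod_add, powerset_univ, mul_sum, mul_sum, mul_sum]
    refine sum_congr rfl fun S _ => ?_
    rw [prod_const]
    ring
  · push Not at hd
    obtain ⟨i, hi⟩ := hd
    simp [tauStarCoeff_eq_zero hi]

lemma mainPoly_coeff (r : ℕ) :
    (mainPoly r).coeff r = ∑' d : Fin r → ℕ, tauStarCoeff d * ∏ i, (d i : ℝ)⁻¹ := by
  simp only [mainPoly, Polynomial.finsetSum_coeff, Polynomial.coeff_monomial]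
  rw [sum_eq_single univ]
  · simp [mainCoeff]
  · intro S _ hS
    rw [if_neg]
    intro h
    exact hS ((card_eq_iff_eq_univ S).mp (by rw [h, Fintype.card_fin]))
  · simp

lemma mainPoly_natDegree (r : ℕ) : (mainPoly r).natDegree = r := by
  refine Polynomial.natDegree_eq_of_le_of_coeff_ne_zero ?_ ?_
  · refine Polynomial.natDegree_sum_le_of_forall_le _ _ fun S _ => ?_
    refine (Polynomial.natDegree_monomial_le _).trans ?_
    simpa using card_le_univ S
  · rw [mainPoly_coeff]
    exact tsum_tauStarCoeff_ne_zero r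

end

theorem mainTheorem5 (r : ℕ) (hr : 2 ≤ r) :
    ∃ P : Polynomial ℝ,
      P.natDegree = r ∧
      HasProd
        (fun p : Nat.Primes =>
          (1 - 1 / ((p : ℕ) : ℝ)) ^ r * (2 - (1 - 1 / ((p : ℕ) : ℝ)) ^ r))
        P.leadingCoeff ∧
      ∀ ε : ℝ, 0 < ε →
        Asymptotics.IsBigO Filter.atTop
          (fun x : ℝ => (tauStarSum r x : ℝ) - x ^ r * P.eval (Real.log x))
          (fun x : ℝ => x ^ ((r : ℝ) - 1 / 2 + ε)) := by
  refine ⟨mainPoly r, mainPoly_natDegree r, ?_, fun ε hε => ?_⟩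
  · rw [Polynomial.leadingCoeff, mainPoly_natDegree, mainPoly_coeff]
    exact hasProd_eulerFactor r
  · have hr0 : (0 : ℝ) < r := by exact_mod_cast (by omega : 0 < r)
    have hδ0 : 0 < min (1 / 4) (ε / r) := lt_min (by norm_num) (div_pos hε hr0)
    obtain ⟨C, hC⟩ := abs_tauStarSum_sub_le r hδ0 (min_le_left _ _)
    have hrδ : r * min (1 / 4) (ε / r) ≤ ε := by
      refine (mul_le_mul_of_nonneg_left (min_le_right _ _) hr0.le).trans (le_of_eq ?_)
      field_simp
    refine Asymptotics.IsBigO.of_bound |C| ?_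
    filter_upwards [Filter.eventually_ge_atTop 1] with x hx
    have hx0 : 0 < x := by linarith
    have h := hC x hx
    rw [tsum_divisorMain r hx0] at h
    rw [Real.norm_eq_abs, Real.norm_of_nonneg (Real.rpow_nonneg hx0.le _)]
    refine h.trans (mul_le_mul (le_abs_self C) ?_ (Real.rpow_nonneg hx0.le _) (abs_nonneg C))
    exact Real.rpow_le_rpow_of_exponent_le hx (by linarith)
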